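/- Let $k\in\mathbb R$. For polynomials in $l_0,l_1,r_0,r_1$, with $\mathbf l=(l_0,l_1)$, $\mathbf r=(r_0,r_1)$ and $\mathbf d=(d_0,d_1)$, put $$H_0(k,\mathbf d)=1+(k-1)k\bigl(d_0+(k-2)(k+1)(6-3(k-3)(k-1)k(k+2)d_1)d_1\bigr),$$ $$H(k)=\tfrac12\bigl(H_0(k,\mathbf l)H_0(k+1,\mathbf r)+H_0(k,\mathbf r)H_0(k+1,\mathbf l)\bigr)-36(k^2-1)k^2(l_1-r_1)^2,$$ $$J_0(k,\mathbf d)=1+(k^2+k+3)d_0+6(k^4+2k^3+k^2+6)d_1-3(k^2-9)(k^2-4)(k^2-1)k(k+4)d_1^2,$$ $$J_1(k,\mathbf d)=1+k(k+1)\bigl(d_0+3(k-1)(k+2)(2-(k-2)k(k+1)(k+3)d_1)d_1\bigr),$$ $$J(k)=\tfrac12\bigl(J_0(k,\mathbf l)J_1(k,\mathbf r)+J_0(k,\mathbf r)J_1(k,\mathbf l)\bigr)+108(k^2-1)k(k+2)(l_1-r_1)^2,$$ $$K_0(k)=1-\tfrac32(k^2-1)k(k+2)(l_1+r_1),\qquad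 K(k)=(l_0-r_0)K_0(k)K_0(-k),$$ $$L(k)=\tfrac34k^2(l_1-r_1)\Bigl(16+4(k^2-1)\bigl(l_0+r_0-4(k^2-1)(l_1+r_1)\bigr)-3(k^2-4)(k^2-1)^2\bigl(3l_0r_1+3l_1r_0+l_0l_1+r_0r_1+16(k^2-6)l_1r_1\bigr)\Bigr).$$ Let $g^*(k)$ be the rational self-map of $\mathbb P^4_{\mathbb R}$, with source coordinates $(l_0:l_1:r_0:r_1:h)$, whose components are the quartic forms obtained from $$\bigl(H(k):K(k)+L(k):J(k):K(k+1)+L(k+1):H(k+1)\bigr)$$ by homogenizing each component to degree $4$ with the variable $h$. Let $LR$ be the left-right symmetry $l_0\leftrightarrow r_0$, $l_1\leftrightarrow r_1$, $h\mapsto h$. Suppose $k\notin\{-\tfrac32,-\tfrac12,\tfrac12\}$. Then: 1. $g^*(k)$ is birational, and its inverse can also be given by quartic forms (possibly with a common factor). If moreover $k\notin\{-3,-2,-1,0,1,2\}$, then $g^*(k)$ has bidegree $(4,4)$: the map and its inverse are given by quartic forms without a common factor. 2. There are a real number $c\neq0$ and a cubic form $S_3$ such that, with $\overline S_3=LR(S_3)$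 (so that $LR(\overline S_3)=S_3$), the determinant of the Jacobian matrix of the five quartic forms is $$\det\mathrm{jac}\,(g^*(k))=c\,h^3\,S_3^2\,\overline S_3^{\,2},$$ and for some quadratic form $Q$, $$S_3=(k-2)(k-1)^2k^3(k+1)^3(k+2)^2(k+3)\,l_1^2r_1+h\,Q.$$ If $k\notin\{-3,-2,-1,0,1,2\}$, then $S_3$ and $\overline S_3$ are irreducible and are not proportional. 3. For $k\in\{-3,\dots,2\}$ the cubics factor as follows. (i) For $k=-3,2$: $S_3=h\,q$ and $\overline S_3=h\,\overline q$ with $q$ and $\overline q=LR(q)$ irreducible, non-proportional quadratic forms, and $\det\mathrm{jac}=c\,h^7q^2\overline q^{\,2}$. (ii) For $k=-2,1$: up to one common nonzero constant, $S_3=h^2(2l_0-12r_1+12l_1+h)$ and $\overline S_3=h^2(2r_0-12l_1+12r_1+h)$, and $\det\mathrm{jac}$ is a nonzero multiple of $h^{11}(2l_0-12r_1+12l_1+h)^2(2r_0-12l_1+12r_1+h)^2$. (iii) For $k=-1,0$: $S_3$ and $\overline S_3$ are the same nonzero multiple of $h^3$, and $\det\mathrm{jac}$ is a nonzero multiple of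 $h^{15}$. -/

import Mathlib

open MvPolynomial

noncomputable section

namespace TwoSided

/-! ### Rational self-maps of projective space, given by forms -/

/-- `F = (F 0 : … : F n)` represents a rational self-map of projective `n`-space by forms of
degree `d`: the components are homogeneous of the same degree `d` and not all of them vanish.
The components may have a common factor. -/
def IsRationalMap {K : Type*} [Field K] {n : ℕ}
    (F : Fin (n + 1) → MvPolynomial (Fin (n + 1)) K) (d : ℕ) : Prop :=
  (∀ i, (F i).IsHomogeneous d) ∧ ∃ i, F i ≠ 0

/-- `F` and `G` are mutually inverse as rational maps: `G ∘ F` and `F ∘ G` are defined and equal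
to the identity of projective space, i.e. their components are `Φ * X i` and `Ψ * X i` for
nonzero `Φ` and `Ψ`. -/
def AreInverse {K : Type*} [Field K] {n : ℕ}
    (F G : Fin (n + 1) → MvPolynomial (Fin (n + 1)) K) : Prop :=
  (∃ Φ, Φ ≠ 0 ∧ ∀ i, bind₁ F (G i) = Φ * X i) ∧
  (∃ Ψ, Ψ ≠ 0 ∧ ∀ i, bind₁ G (F i) = Ψ * X i)

/-- The components of `F` have no common factor apart from units. -/
def NoCommonFactor {K : Type*} [Field K] {n : ℕ}
    (F : Fin (n + 1) → MvPolynomial (Fin (n + 1)) K) : Prop :=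
  ∀ p, (∀ i, p ∣ F i) → IsUnit p

/-- `F` represents a birational self-map of projective space, where `F` consists of forms of
degree `d` and the inverse can be given by forms of degree `e` (common factors are allowed). -/
def IsBirational {K : Type*} [Field K] {n : ℕ}
    (F : Fin (n + 1) → MvPolynomial (Fin (n + 1)) K) (d e : ℕ) : Prop :=
  IsRationalMap F d ∧ ∃ G, IsRationalMap G e ∧ AreInverse F G

/-- `F` represents a birational self-map of projective space of bidegree `(d, e)`: here `d` and `e`
are the degrees of the map and of its inverse, both written without common factors. -/
def HasBidegree {K : Type*} [Field K] {n : ℕ}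
    (F : Fin (n + 1) → MvPolynomial (Fin (n + 1)) K) (d e : ℕ) : Prop :=
  ∃ F' p, p ≠ 0 ∧ (∀ i, F i = p * F' i) ∧ IsRationalMap F' d ∧ NoCommonFactor F' ∧
    ∃ G, IsRationalMap G e ∧ NoCommonFactor G ∧ AreInverse F' G

/-- The determinant of the Jacobian matrix of the tuple `F`. -/
def detJac {K : Type*} [Field K] {n : ℕ}
    (F : Fin (n + 1) → MvPolynomial (Fin (n + 1)) K) : MvPolynomial (Fin (n + 1)) K :=
  (Matrix.of fun i j => pderiv j (F i)).det

/-! ### The two-sided map, `n = 2`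

The coordinates on the source are `(l₀ : l₁ : r₀ : r₁ : h)`, where `h` is the homogenizing
variable: putting `h = 1` gives the affine formulas. -/

/-- Real polynomials in `l₀, l₁, r₀, r₁, h`. -/
abbrev Poly : Type := MvPolynomial (Fin 5) ℝ

def l0 : Poly := X 0
def l1 : Poly := X 1
def r0 : Poly := X 2
def r1 : Poly := X 3
def h : Poly := X 4

/-- The left-right symmetry: exchange `l₀` with `r₀` and `l₁` with `r₁`, keep `h`. -/
def LR (p : Poly) : Poly := rename ![2, 3, 0, 1, 4] p

def H0 (k : ℝ) (d0 d1 : Poly) : Poly :=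
  h ^ 2 + C ((k - 1) * k) *
    (d0 * h + C ((k - 2) * (k + 1)) *
      (6 * h - C (3 * (k - 3) * (k - 1) * k * (k + 2)) * d1) * d1)

def H (k : ℝ) : Poly :=
  C (1 / 2) * (H0 k l0 l1 * H0 (k + 1) r0 r1 + H0 k r0 r1 * H0 (k + 1) l0 l1)
    - C (36 * (k ^ 2 - 1) * k ^ 2) * (l1 - r1) ^ 2 * h ^ 2

def J0 (k : ℝ) (d0 d1 : Poly) : Poly :=
  h ^ 2 + C (k ^ 2 + k + 3) * d0 * h + C (6 * (k ^ 4 + 2 * k ^ 3 + k ^ 2 + 6)) * d1 * h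
    - C (3 * (k ^ 2 - 9) * (k ^ 2 - 4) * (k ^ 2 - 1) * k * (k + 4)) * d1 ^ 2

def J1 (k : ℝ) (d0 d1 : Poly) : Poly :=
  h ^ 2 + C (k * (k + 1)) *
    (d0 * h + C (3 * (k - 1) * (k + 2)) *
      (2 * h - C ((k - 2) * k * (k + 1) * (k + 3)) * d1) * d1)

def J (k : ℝ) : Poly :=
  C (1 / 2) * (J0 k l0 l1 * J1 k r0 r1 + J0 k r0 r1 * J1 k l0 l1)
    + C (108 * (k ^ 2 - 1) * k * (k + 2)) * (l1 - r1) ^ 2 * h ^ 2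

def K0 (k : ℝ) : Poly :=
  h - C (3 / 2 * (k ^ 2 - 1) * k * (k + 2)) * (l1 + r1)

def K (k : ℝ) : Poly := (l0 - r0) * K0 k * K0 (-k) * h

def L (k : ℝ) : Poly :=
  C (3 / 4 * k ^ 2) * (l1 - r1) *
    (16 * h ^ 2
      + C (4 * (k ^ 2 - 1)) * (l0 + r0 - C (4 * (k ^ 2 - 1)) * (l1 + r1)) * h
      - C (3 * (k ^ 2 - 4) * (k ^ 2 - 1) ^ 2) *
        (3 * l0 * r1 + 3 * l1 * r0 + l0 * l1 + r0 * r1 + C (16 * (k ^ 2 - 6)) * l1 * r1)) * h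

/-- The map `g*(k)` from `(l₀ : l₁ : r₀ : r₁ : h)` to `(j₀ : j₁ : j₂ : j₃ : j₄)`. -/
def gStar (k : ℝ) : Fin 5 → Poly :=
  ![H k, K k + L k, J k, K (k + 1) + L (k + 1), H (k + 1)]

/-- The coefficient of `l₁² r₁` in the cubic. -/
def cubicCoeff (k : ℝ) : ℝ :=
  (k - 2) * (k - 1) ^ 2 * k ^ 3 * (k + 1) ^ 3 * (k + 2) ^ 2 * (k + 3)

end TwoSided

end

/-!
The proof rests on a linear change of the target coordinates. Put `m = k (k + 1)`. Away from the
three excluded values of `k` there is an invertible matrix (`adaptedMatrix`) which turns the five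
quartic forms into `h T`, `h D`, `l₁ T`, `r₁ S` and `J`, where `S` is a cubic form, `T = LR S` and
`D = (T - S) / m` (`adaptedMatrix_apply`). The cubic `S` is affine in `l₀` and free of `r₀`, and it
depends on `k` only through `m`; dividing it by `9` gives the leading coefficient `cubicCoeff k`.
Working with `D` instead of `S` keeps the matrix invertible for `m = 0` too.

*Inverse.* Let `a`, `d`, `x`, `y`, `t` be the values of the five forms and `b = a - m d`, the value
of `h S`. Then `l₁ / h = x / a` and `r₁ / h = y / b`. The identity `recovery` expresses `r₀ h S`
through `J`, `S`, `D` and forms in `l₁`, `r₁`, `h`, so that `r₀ / h`, and by symmetry `l₀ / h`, is a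
rational function with denominator `a² b²`. This gives quartic forms `G` with
`G ∘ F = h³ S² T² · id`. That `F ∘ G` is the identity as well follows formally, since the components
of `F` are algebraically independent by the Jacobian criterion (`areInverse_of_leftInverse`).

*Jacobian determinant.* With Euler's identity and row operations the determinant in the adapted
coordinates reduces to a `3 × 3` determinant, which `det_adapted_minor` evaluates; the result is
`4 (m + 3) h³ S² T²`, where `m + 3` is positive.

*Irreducibility.* Being affine in `l₀`, the cubic `S` is irreducible as soon as its two coefficients
are relatively prime, which holds unless `m` is `0`, `2` or `6`, that is, unless
`k ∈ {-3, …, 2}`. An irreducible common factor of the forms would divide `h`, or both `S` and `T`;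
one of the inverse forms would be `a` or `b`. Both are ruled out by evaluation at suitable points.
-/

namespace TwoSided

/-! ### Rational maps given by forms -/

section General

variable {K : Type*} [Field K]

theorem pderiv_bind₁ {n : ℕ} (F : Fin n → MvPolynomial (Fin n) K) (j : Fin n)
    (p : MvPolynomial (Fin n) K) :
    pderiv j (bind₁ F p) = ∑ i, bind₁ F (pderiv i p) * pderiv j (F i) := by
  induction p using MvPolynomial.induction_on with
  | C a => simp
  | add p q hp hq => simp only [map_add, hp, hq, add_mul, Finset.sum_add_distrib]
  | mul_X p i hp =>
    simp only [map_mul, Derivation.leibniz, smul_eq_mul, hp, bind₁_X_right, map_add, pderiv_X,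
      add_mul, Finset.sum_add_distrib, Finset.mul_sum]
    congr 1
    · simp [Pi.single_apply, apply_ite, ite_mul]
    · exact Finset.sum_congr rfl fun _ _ => by ring

theorem totalDegree_pderiv_le {σ : Type*} (i : σ) (p : MvPolynomial σ K) :
    (pderiv i p).totalDegree ≤ p.totalDegree - 1 := by
  refine Finset.sup_le fun m hm => ?_
  have hm' : m + Finsupp.single i 1 ∈ p.support := by
    rw [mem_support_iff, coeff_pderiv] at hm
    exact mem_support_iff.mpr (left_ne_zero_of_mul hm)
  have := le_totalDegree hm'
  rw [Finsupp.sum_add_index' (fun _ => rfl) (fun _ _ _ => rfl),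
    Finsupp.sum_single_index rfl] at this
  omega

theorem coeff_eq_zero_of_pderiv_eq_zero [CharZero K] {σ : Type*} {i : σ}
    {p : MvPolynomial σ K} (hp : pderiv i p = 0) {m : σ →₀ ℕ} (hm : m i ≠ 0) : coeff m p = 0 := by
  have hle : Finsupp.single i 1 ≤ m := by
    rw [Finsupp.single_le_iff]
    exact Nat.one_le_iff_ne_zero.mpr hm
  have h0 := congrArg (coeff (m - Finsupp.single i 1)) hp
  rw [coeff_pderiv, tsub_add_cancel_of_le hle, coeff_zero] at h0
  exact (mul_eq_zero.mp h0).resolve_right (Nat.cast_add_one_ne_zero _)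

theorem notMem_vars_of_pderiv_eq_zero [CharZero K] {σ : Type*} {i : σ}
    {p : MvPolynomial σ K} (hp : pderiv i p = 0) : i ∉ p.vars := by
  rw [mem_vars_iff_mem_support]
  rintro ⟨m, hm, hi⟩
  exact mem_support_iff.mp hm
    (coeff_eq_zero_of_pderiv_eq_zero hp (Finsupp.mem_support_iff.mp hi))

theorem eq_C_of_pderiv_eq_zero [CharZero K] {σ : Type*} {p : MvPolynomial σ K}
    (hp : ∀ i, pderiv i p = 0) : p = C (coeff 0 p) := by
  classical
  ext m
  rw [coeff_C]
  split_ifs with hm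
  · rw [hm]
  · obtain ⟨i, hi⟩ := Finsupp.ne_iff.mp (Ne.symm hm)
    exact coeff_eq_zero_of_pderiv_eq_zero (hp i) hi

/-- The Jacobian criterion: polynomials with nonzero Jacobian determinant are algebraically
independent in characteristic zero. By the chain rule, every partial derivative of a relation is
again a relation, of smaller degree. -/
theorem eq_zero_of_bind₁_eq_zero [CharZero K] {n : ℕ}
    {F : Fin (n + 1) → MvPolynomial (Fin (n + 1)) K} (hF : detJac F ≠ 0)
    {p : MvPolynomial (Fin (n + 1)) K} (hp : bind₁ F p = 0) : p = 0 := by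
  obtain ⟨d, hd⟩ : ∃ d, p.totalDegree ≤ d := ⟨_, le_rfl⟩
  induction d generalizing p with
  | zero =>
    rw [totalDegree_eq_zero_iff_eq_C.mp (Nat.le_zero.mp hd), bind₁, aeval_C] at hp
    rw [totalDegree_eq_zero_iff_eq_C.mp (Nat.le_zero.mp hd)]
    exact hp
  | succ d ih =>
    have hker : (fun i => bind₁ F (pderiv i p)) = 0 := by
      refine Matrix.eq_zero_of_vecMul_eq_zero hF (_root_.funext fun j => ?_)
      have := pderiv_bind₁ F j p
      rw [hp, map_zero] at this
      simpa [Matrix.vecMul, dotProduct] using this.symm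
    have hpd : ∀ i, pderiv i p = 0 := fun i =>
      ih (congrFun hker i) ((totalDegree_pderiv_le i p).trans (by omega))
    rw [eq_C_of_pderiv_eq_zero hpd, bind₁, aeval_C] at hp
    rw [eq_C_of_pderiv_eq_zero hpd]
    exact hp

theorem bind₁_mul_X_of_isHomogeneous {n d : ℕ} {p Φ : MvPolynomial (Fin n) K}
    (hp : p.IsHomogeneous d) : bind₁ (fun i => Φ * X i) p = Φ ^ d * p := by
  conv_lhs => rw [p.as_sum]
  conv_rhs => rw [p.as_sum]
  rw [map_sum, Finset.mul_sum]
  refine Finset.sum_congr rfl fun m hm => ?_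
  have hdeg : m.degree = d := by
    have := hp (mem_support_iff.mp hm)
    rwa [show (1 : Fin n → ℕ) = fun _ => 1 from rfl, ← Finsupp.degree_eq_weight_one] at this
  rw [bind₁_monomial, monomial_eq, Finsupp.prod]
  simp only [mul_pow]
  rw [Finset.prod_mul_distrib, Finset.prod_pow_eq_pow_sum, ← hdeg, Finsupp.degree_apply]
  ring

/-- A rational map with nonzero Jacobian determinant that has a left inverse is birational:
substituting `F` is injective, so the relation `F ∘ G ∘ F = F` can be cancelled to `F ∘ G = id`. -/
theorem areInverse_of_leftInverse [CharZero K] {n d : ℕ}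
    {F G : Fin (n + 2) → MvPolynomial (Fin (n + 2)) K} (hF : IsRationalMap F d)
    (hdet : detJac F ≠ 0) {Φ : MvPolynomial (Fin (n + 2)) K} (hΦ : Φ ≠ 0)
    (hGF : ∀ i, bind₁ F (G i) = Φ * X i) : AreInverse F G := by
  refine ⟨⟨Φ, hΦ, hGF⟩, ?_⟩
  have hFGF : ∀ i, bind₁ F (bind₁ G (F i)) = Φ ^ d * F i := fun i => by
    rw [bind₁_bind₁, ← bind₁_mul_X_of_isHomogeneous (hF.1 i)]
    simp only [hGF]
  have hprop : ∀ i j, bind₁ G (F i) * X j = bind₁ G (F j) * X i := fun i j => by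
    rw [← sub_eq_zero]
    apply eq_zero_of_bind₁_eq_zero hdet
    simp only [map_sub, map_mul, hFGF, bind₁_X_right]
    ring
  have hX : ∀ i : Fin (n + 2), (X i : MvPolynomial (Fin (n + 2)) K) ≠ 0 := fun i => X_ne_zero i
  obtain ⟨Ψ, hΨ⟩ : (X 0 : MvPolynomial (Fin (n + 2)) K) ∣ bind₁ G (F 0) := by
    have : (X 0 : MvPolynomial (Fin (n + 2)) K) ∣ bind₁ G (F 0) * X 1 :=
      ⟨bind₁ G (F 1), by rw [hprop 0 1, mul_comm]⟩
    refine (X_prime.dvd_or_dvd this).resolve_right fun h01 => ?_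
    rw [X_dvd_X] at h01
    exact absurd h01 (by simp)
  have hall : ∀ i, bind₁ G (F i) = Ψ * X i := fun i => by
    apply mul_right_cancel₀ (hX 0)
    rw [hprop i 0, hΨ]
    ring
  refine ⟨Ψ, ?_, hall⟩
  rintro rfl
  obtain ⟨i, hi⟩ := hF.2
  have := hFGF i
  rw [hall, zero_mul, map_zero] at this
  exact mul_ne_zero (pow_ne_zero d hΦ) hi this.symm

/-- The linear forms whose coefficients are the rows of a matrix. -/
noncomputable def linearForms {n : ℕ} (A : Matrix (Fin n) (Fin n) K) (i : Fin n) :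
    MvPolynomial (Fin n) K := ∑ j, C (A i j) * X j

theorem linearForms_isHomogeneous {n : ℕ} (A : Matrix (Fin n) (Fin n) K) (i : Fin n) :
    (linearForms A i).IsHomogeneous 1 :=
  IsHomogeneous.sum _ _ _ fun j _ => by
    simpa using (isHomogeneous_C (Fin n) (A i j)).mul (isHomogeneous_X K j)

theorem bind₁_linearForms {n : ℕ} (A : Matrix (Fin n) (Fin n) K)
    (F : Fin n → MvPolynomial (Fin n) K) (i : Fin n) :
    bind₁ F (linearForms A i) = ∑ j, C (A i j) * F j := by
  simp [linearForms, map_sum, algHom_C]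

/-- The Jacobian determinant of a linear change of target coordinates. -/
theorem detJac_linear {n : ℕ} (A : Matrix (Fin (n + 1)) (Fin (n + 1)) K)
    (F Z : Fin (n + 1) → MvPolynomial (Fin (n + 1)) K) (hZ : ∀ i, ∑ j, C (A i j) * F j = Z i) :
    detJac Z = C A.det * detJac F := by
  have : (Matrix.of fun i j => pderiv j (Z i)) =
      A.map (C : K →+* MvPolynomial (Fin (n + 1)) K) * Matrix.of fun i j => pderiv j (F i) := by
    ext1 i j
    simp [Matrix.mul_apply, ← hZ]
  rw [detJac, this, Matrix.det_mul, detJac, RingHom.map_det]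
  rfl

theorem bind₁_linearForms_bind₁ {n : ℕ} {A B : Matrix (Fin n) (Fin n) K} (hAB : A * B = 1)
    (p : MvPolynomial (Fin n) K) : bind₁ (linearForms B) (bind₁ (linearForms A) p) = p := by
  have : (fun i => bind₁ (linearForms B) (linearForms A i)) = X := by
    funext i
    rw [bind₁_linearForms]
    simp only [linearForms, Finset.mul_sum, ← mul_assoc, ← map_mul]
    rw [Finset.sum_comm]
    simp only [← Finset.sum_mul, ← map_sum, ← Matrix.mul_apply, hAB]
    simp [Matrix.one_apply]
  rw [bind₁_bind₁, this]
  simp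

theorem noCommonFactor_bind₁_linearForms {n : ℕ}
    {A : Matrix (Fin (n + 1)) (Fin (n + 1)) K} (hA : IsUnit A.det)
    {Γ : Fin (n + 1) → MvPolynomial (Fin (n + 1)) K} (hΓ : NoCommonFactor Γ) :
    NoCommonFactor fun i => bind₁ (linearForms A) (Γ i) := by
  intro p hp
  have hu : IsUnit (bind₁ (linearForms A⁻¹) p) := hΓ _ fun i => by
    have := map_dvd (bind₁ (linearForms A⁻¹)) (hp i)
    rwa [bind₁_linearForms_bind₁ (Matrix.mul_nonsing_inv A hA)] at this
  rw [← bind₁_linearForms_bind₁ (Matrix.nonsing_inv_mul A hA) p]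
  exact hu.map _

/-- The components have no common factor as soon as no irreducible polynomial divides all of
them. -/
theorem noCommonFactor_of_irreducible {n : ℕ}
    {F : Fin (n + 1) → MvPolynomial (Fin (n + 1)) K} {i : Fin (n + 1)} (hi : F i ≠ 0)
    (hF : ∀ p, Irreducible p → ∃ i, ¬ p ∣ F i) : NoCommonFactor F := by
  intro p hp
  by_contra hu
  obtain ⟨q, hq, hqp⟩ := WfDvdMonoid.exists_irreducible_factor hu
    (ne_zero_of_dvd_ne_zero hi (hp i))
  obtain ⟨j, hj⟩ := hF q hq
  exact hj (hqp.trans (hp j))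

theorem coeff_bind₁_C_mul_X {n : ℕ} (c : K) (m : Fin n →₀ ℕ) (p : MvPolynomial (Fin n) K) :
    coeff m (bind₁ (fun i => C c * X i) p) = c ^ m.degree * coeff m p := by
  classical
  induction p using MvPolynomial.induction_on' with
  | monomial u a =>
    have : bind₁ (fun i => C c * X i) (monomial u a) = C (c ^ u.degree) * monomial u a := by
      rw [bind₁_mul_X_of_isHomogeneous (isHomogeneous_monomial a rfl), map_pow]
    rw [this, coeff_C_mul, coeff_monomial]
    split_ifs with hu
    · rw [hu]
    · simp
  | add p q hp hq => rw [map_add, coeff_add, hp, hq, coeff_add, mul_add]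

/-- Over the reals, a polynomial is homogeneous as soon as its values scale correctly under
doubling of the variables. -/
theorem isHomogeneous_of_eval_two_mul {n d : ℕ} {p : MvPolynomial (Fin n) ℝ}
    (hp : ∀ x : Fin n → ℝ, eval (fun i => 2 * x i) p = 2 ^ d * eval x p) :
    p.IsHomogeneous d := by
  have hscale : bind₁ (fun i => C 2 * X i) p = C (2 ^ d) * p :=
    MvPolynomial.funext fun x => by
      rw [map_mul, eval_C, ← hp x]
      have hx : (fun i => eval x (C 2 * X i)) = fun i => 2 * x i := by
        funext i
        rw [map_mul, eval_C, eval_X]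
      rw [← hx]
      exact eval₂Hom_bind₁ (RingHom.id ℝ) x (fun i => C 2 * X i) p
  intro m hm
  have h2 := congrArg (coeff m) hscale
  rw [coeff_bind₁_C_mul_X, coeff_C_mul] at h2
  have h3 : m.degree = d :=
    Nat.pow_right_injective le_rfl (by exact_mod_cast mul_right_cancel₀ hm h2)
  rw [← h3, Finsupp.degree_eq_weight_one]
  rfl

end General
/-! ### The cubic and the identities behind the inverse -/

section Identities

variable {R : Type*} [CommRing R]

/-- The cubic, normalised to have leading term `z³`. It is affine in `x₀`, and the other
zeroth coordinate does not occur. The parameter is `m = k (k + 1)`. -/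
def cubic (m x0 x1 y1 z : R) : R :=
  z ^ 3 + m * x0 * z ^ 2 - 3 * m ^ 2 * y1 * z ^ 2 + 6 * m * (m - 1) * x1 * z ^ 2
    - 3 * m ^ 3 * (m - 2) * x1 ^ 2 * z - 18 * (m - 3) * m ^ 2 * (m - 2) * x1 * y1 * z
    - 3 * m ^ 2 * (m - 2) * x0 * y1 * z + 9 * m ^ 3 * (m - 2) ^ 2 * (m - 6) * x1 ^ 2 * y1

/-- The difference of the two conjugate cubics, divided by `m`. -/
def cubicDiff (m x0 x1 y0 y1 z : R) : R :=
  (y0 - x0) * z ^ 2 + (9 * m - 6) * (y1 - x1) * z ^ 2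
    - 3 * m ^ 2 * (m - 2) * (y1 ^ 2 - x1 ^ 2) * z + 3 * m * (m - 2) * (x0 * y1 - x1 * y0) * z
    + 9 * m ^ 2 * (m - 2) ^ 2 * (m - 6) * x1 * y1 * (y1 - x1)

/-- The factor of the coefficient of `x₀` in the cubic. -/
def leadFactor (m y1 z : R) : R := z - 3 * m * (m - 2) * y1

/-- The factor `J₀` of the middle component, in terms of `m = k (k + 1)`. -/
def midFactor₀ (m d0 d1 z : R) : R :=
  z ^ 2 + (m + 3) * d0 * z + 6 * (m ^ 2 + 6) * d1 * z
    - 3 * (m - 12) * (m - 6) * (m - 2) * m * d1 ^ 2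

/-- The factor `J₁` of the middle component, in terms of `m = k (k + 1)`. -/
def midFactor₁ (m d0 d1 z : R) : R :=
  z ^ 2 + m * (d0 * z + 3 * (m - 2) * (2 * z - (m - 6) * m * d1) * d1)

/-- Twice the middle component, in terms of `m = k (k + 1)`. -/
def twiceMid (m x0 x1 y0 y1 z : R) : R :=
  midFactor₀ m x0 x1 z * midFactor₁ m y0 y1 z + midFactor₀ m y0 y1 z * midFactor₁ m x0 x1 z
    + 216 * m * (m - 2) * (x1 - y1) ^ 2 * z ^ 2

/-- The quadratic coefficient of the cubics in `twiceMid_relation`, as a bilinear form in `(x, u)`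
and `(y, v)`. On the source both `u` and `v` are the homogenizing variable; on the target, where
`x₁ / z` and `y₁ / z` have different denominators, they are distinct. -/
def mixedForm (m x u y v : R) : R :=
  45 * m ^ 2 * (m - 2) * (m - 6) * x * y + (21 * m + 18) * m * x * v
    - 27 * m * (m - 2) * u * y - 3 * u * v

/-- The form which, with `mixedForm`, expresses `y₀` by the components of the map. It is
bihomogeneous of bidegree `(2, 2)` in `(x, u)` and `(y, v)`; for `u = v = z` it is `z ^ 2` times a
quadratic form. -/
def recoveryForm (m x u y v : R) : R :=
  45 * m * (m - 2) * (m - 6) * x * y * u * v - 27 * (m - 2) * x * u * v ^ 2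
    - 3 * m * (m - 2) * (2 * m - 9) * (m - 6) * y ^ 2 * u ^ 2
    + (12 * m ^ 2 + 27 * m + 18) * y * v * u ^ 2 + 2 * u ^ 2 * v ^ 2

theorem cubic_sub_cubic (m x0 x1 y0 y1 z : R) :
    cubic m y0 y1 x1 z - m * cubicDiff m x0 x1 y0 y1 z = cubic m x0 x1 y1 z := by
  unfold cubic cubicDiff; ring

/-- The middle component is a combination of the two cubics and their product. -/
theorem twiceMid_relation (m x0 x1 y0 y1 z : R) :
    m * leadFactor m x1 z * leadFactor m y1 z * twiceMid m x0 x1 y0 y1 z =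
      2 * (m + 3) * cubic m x0 x1 y1 z * cubic m y0 y1 x1 z
        + leadFactor m y1 z * mixedForm m x1 z y1 z * cubic m x0 x1 y1 z
        + leadFactor m x1 z * mixedForm m y1 z x1 z * cubic m y0 y1 x1 z := by
  unfold cubic leadFactor twiceMid midFactor₀ midFactor₁ mixedForm; ring

/-- The relation from which `y₀` is recovered. It is `twiceMid_relation` with the second cubic
written as an affine function of `y₀`, divided by `m` and by the leading factor of that function. -/
theorem recovery (m x0 x1 y0 y1 z : R) :
    2 * (m + 3) * y0 * z ^ 3 * cubic m x0 x1 y1 z =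
      z ^ 2 * (leadFactor m y1 z * twiceMid m x0 x1 y0 y1 z
        - mixedForm m y1 z x1 z * cubicDiff m x0 x1 y0 y1 z)
      - recoveryForm m x1 z y1 z * cubic m x0 x1 y1 z := by
  unfold cubic leadFactor twiceMid midFactor₀ midFactor₁ mixedForm cubicDiff recoveryForm; ring

/-- A component of the inverse map, up to the constant factor `2 (m + 3)`: `recovery` solved for
`y₀`, in terms of the values `t` of `twiceMid`, `d` of `z D`, `x, u` of `x₁ T, z T` and `y, v` of
`y₁ S, z S`, where `S` and `T` are the two cubics and `D` is `cubicDiff`. -/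
def inverseForm (m t d x u y v : R) : R :=
  leadFactor m y v * t * u ^ 2 - recoveryForm m x u y v - mixedForm m y v x u * d * u

/-- The two cubics enter through the ratios `x / u = x₁ / z` and `y / v = y₁ / z`, in which they
cancel. -/
theorem inverseForm_apply (m x0 x1 y0 y1 z : R) :
    inverseForm m (twiceMid m x0 x1 y0 y1 z) (z * cubicDiff m x0 x1 y0 y1 z)
      (x1 * cubic m y0 y1 x1 z) (z * cubic m y0 y1 x1 z)
      (y1 * cubic m x0 x1 y1 z) (z * cubic m x0 x1 y1 z) =
    2 * (m + 3) * (z ^ 3 * cubic m x0 x1 y1 z ^ 2 * cubic m y0 y1 x1 z ^ 2) * y0 := by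
  have h1 := recovery m x0 x1 y0 y1 z
  generalize cubic m x0 x1 y1 z = S at *
  generalize cubic m y0 y1 x1 z = T at *
  generalize cubicDiff m x0 x1 y0 y1 z = D at *
  generalize twiceMid m x0 x1 y0 y1 z = t at *
  unfold inverseForm leadFactor recoveryForm mixedForm
  unfold leadFactor recoveryForm mixedForm at h1
  linear_combination (-S * T ^ 2) * h1

theorem twiceMid_swap (m x0 x1 y0 y1 z : R) :
    twiceMid m y0 y1 x0 x1 z = twiceMid m x0 x1 y0 y1 z := by
  unfold twiceMid; ring

theorem cubicDiff_swap (m x0 x1 y0 y1 z : R) :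
    cubicDiff m y0 y1 x0 x1 z = -cubicDiff m x0 x1 y0 y1 z := by
  unfold cubicDiff; ring

end Identities

/-! ### The Jacobian determinant in adapted coordinates -/

section Determinant

variable {R : Type*} [CommRing R]

/-- The determinant of the matrix whose rows are the gradients of `z T`, `z D`, `x₁ T`, `y₁ S`
and `t`, where `S = T - m D`. Euler's identity replaces the column of `z`-derivatives by the values
of the forms, and subtracting multiples of the first two rows leaves a single entry in each of the
third and fourth rows. -/
theorem det_adapted (m x0 x1 y0 y1 z T D t s0 s1 s2 s3 s4 d0 d1 d2 d3 d4 j0 j1 j2 j3 j4 : R)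
    (hT : x0 * s0 + x1 * s1 + y0 * s2 + y1 * s3 + z * s4 = 3 * T)
    (hD : x0 * d0 + x1 * d1 + y0 * d2 + y1 * d3 + z * d4 = 3 * D)
    (ht : x0 * j0 + x1 * j1 + y0 * j2 + y1 * j3 + z * j4 = 4 * t) :
    z ^ 3 * (!![z * s0, z * s1, z * s2, z * s3, z * s4 + T;
        z * d0, z * d1, z * d2, z * d3, z * d4 + D;
        x1 * s0, x1 * s1 + T, x1 * s2, x1 * s3, x1 * s4;
        y1 * (s0 - m * d0), y1 * (s1 - m * d1), y1 * (s2 - m * d2),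
          y1 * (s3 - m * d3) + (T - m * D), y1 * (s4 - m * d4);
        j0, j1, j2, j3, j4] : Matrix (Fin 5) (Fin 5) R).det =
      -(4 * z ^ 4 * T * (T - m * D)) *
        !![s0, s2, T; d0, d2, D; j0, j2, t].det := by
  set M : Matrix (Fin 5) (Fin 5) R := !![z * s0, z * s1, z * s2, z * s3, z * s4 + T;
        z * d0, z * d1, z * d2, z * d3, z * d4 + D;
        x1 * s0, x1 * s1 + T, x1 * s2, x1 * s3, x1 * s4;
        y1 * (s0 - m * d0), y1 * (s1 - m * d1), y1 * (s2 - m * d2),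
          y1 * (s3 - m * d3) + (T - m * D), y1 * (s4 - m * d4);
        j0, j1, j2, j3, j4] with hM
  have hP : (!![1, 0, 0, 0, 0; 0, 1, 0, 0, 0; -x1, 0, z, 0, 0; -y1, y1 * m, 0, z, 0;
      0, 0, 0, 0, 1] : Matrix (Fin 5) (Fin 5) R).det = z ^ 2 := by
    simp [Matrix.det_succ_row_zero, Fin.sum_univ_succ, Fin.succAbove]
    ring
  have hQ : (!![1, 0, 0, 0, x0; 0, 1, 0, 0, x1; 0, 0, 1, 0, y0; 0, 0, 0, 1, y1;
      0, 0, 0, 0, z] : Matrix (Fin 5) (Fin 5) R).det = z := by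
    simp [Matrix.det_succ_row_zero, Fin.sum_univ_succ, Fin.succAbove]
  have hPMQ : (!![1, 0, 0, 0, 0; 0, 1, 0, 0, 0; -x1, 0, z, 0, 0; -y1, y1 * m, 0, z, 0;
      0, 0, 0, 0, 1] : Matrix (Fin 5) (Fin 5) R) * M *
      !![1, 0, 0, 0, x0; 0, 1, 0, 0, x1; 0, 0, 1, 0, y0; 0, 0, 0, 1, y1; 0, 0, 0, 0, z] =
      !![z * s0, z * s1, z * s2, z * s3, 4 * z * T; z * d0, z * d1, z * d2, z * d3, 4 * z * D;
        0, z * T, 0, 0, 0; 0, 0, 0, z * (T - m * D), 0; j0, j1, j2, j3, 4 * t] := by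
    ext i j
    fin_cases i <;> fin_cases j <;>
      simp [hM, Matrix.mul_apply, Fin.sum_univ_succ]
    all_goals first
      | ring1
      | linear_combination z * hT
      | linear_combination z * hD
      | linear_combination ht
  have hdet := congrArg Matrix.det hPMQ
  rw [Matrix.det_mul, Matrix.det_mul, hP, hQ] at hdet
  rw [show z ^ 3 * M.det = z ^ 2 * M.det * z by ring, hdet]
  simp [Matrix.det_succ_row_zero, Fin.sum_univ_succ, Fin.succAbove]
  ring

/-- The remaining `3 × 3` determinant; it is the derivative of `twiceMid_relation`. -/
theorem det_adapted_minor (m x0 x1 y0 y1 z : R) :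
    !![0, m * (z * leadFactor m x1 z), cubic m y0 y1 x1 z;
      -(z * leadFactor m y1 z), z * leadFactor m x1 z, cubicDiff m x0 x1 y0 y1 z;
      (m + 3) * z * midFactor₁ m y0 y1 z + midFactor₀ m y0 y1 z * (m * z),
      midFactor₀ m x0 x1 z * (m * z) + (m + 3) * z * midFactor₁ m x0 x1 z,
      twiceMid m x0 x1 y0 y1 z].det =
    -(2 * (m + 3) * z ^ 2 * cubic m x0 x1 y1 z * cubic m y0 y1 x1 z) := by
  rw [Matrix.det_fin_three]
  simp only [Matrix.of_apply, Matrix.cons_val]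
  unfold cubic leadFactor twiceMid midFactor₀ midFactor₁ cubicDiff; ring

end Determinant
/-! ### Adapted linear coordinates on the target -/

/-- The cubic as a polynomial in the source coordinates. -/
noncomputable def cubicS (k : ℝ) : Poly := cubic (C (k * (k + 1))) l0 l1 r1 h

/-- The conjugate of `cubicS`. -/
noncomputable def cubicT (k : ℝ) : Poly := cubic (C (k * (k + 1))) r0 r1 l1 h

/-- The difference of the conjugate cubics, divided by `k (k + 1)`. -/
noncomputable def cubicD (k : ℝ) : Poly := cubicDiff (C (k * (k + 1))) l0 l1 r0 r1 h

/-- The map in adapted linear coordinates of the target. -/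
noncomputable def adapted (k : ℝ) : Fin 5 → Poly :=
  ![h * cubicT k, h * cubicD k, l1 * cubicT k, r1 * cubicS k, J k]

/-- The numerators of the linear change of target coordinates from `gStar` to `adapted`. -/
def adaptedNum (k : ℝ) : Matrix (Fin 5) (Fin 5) ℝ :=
  !![(k + 1) * (k + 2) * (k + 3) * (k + 4) * (2 * k - 1),
      -(k * (k + 1) * (k + 2) * (k + 3) * (2 * k - 1) * (2 * k + 3)),
      -(2 * (k - 1) * k * (k + 1) * (k + 2) * (2 * k + 1)),
      k * (k + 1) * (k - 1) * (k - 2) * (2 * k - 1) * (2 * k + 3),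
      k * (k - 1) * (k - 2) * (k - 3) * (2 * k + 3);
    0, -((k + 2) * (k + 3)), 0, (k - 1) * (k - 2), 0;
    2 * k - 1, -((2 * k - 1) * (2 * k + 3)), -(2 * (2 * k + 1)), (2 * k - 1) * (2 * k + 3),
      2 * k + 3;
    2 * k - 1, (2 * k - 1) * (2 * k + 3), -(2 * (2 * k + 1)), -((2 * k - 1) * (2 * k + 3)),
      2 * k + 3;
    0, 0, 1, 0, 0]

/-- The denominators of the rows of the change of coordinates; they vanish exactly for the three
excluded values of `k`. -/
def adaptedDen (k : ℝ) : Fin 5 → ℝ :=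
  ![8 * ((2 * k - 1) * (2 * k + 1) * (2 * k + 3)), 4 * (2 * k + 1),
    24 * ((2 * k - 1) * (2 * k + 1) * (2 * k + 3)),
    24 * ((2 * k - 1) * (2 * k + 1) * (2 * k + 3)), 1]

/-- The linear change of target coordinates from `gStar` to `adapted`. -/
noncomputable def adaptedMatrix (k : ℝ) : Matrix (Fin 5) (Fin 5) ℝ :=
  Matrix.of fun i j => (adaptedDen k i)⁻¹ * adaptedNum k i j

theorem adaptedDen_ne_zero {k : ℝ} (hk : k ∉ ({-3 / 2, -1 / 2, 1 / 2} : Set ℝ)) (i : Fin 5) :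
    adaptedDen k i ≠ 0 := by
  simp only [Set.mem_insert_iff, Set.mem_singleton_iff, not_or] at hk
  have h1 : 2 * k - 1 ≠ 0 := fun h => hk.2.2 (by linarith)
  have h2 : 2 * k + 1 ≠ 0 := fun h => hk.2.1 (by linarith)
  have h3 : 2 * k + 3 ≠ 0 := fun h => hk.1 (by linarith)
  fin_cases i <;> simp [adaptedDen, h1, h2, h3]

theorem k_sq_add_pos (k : ℝ) : 0 < k * (k + 1) + 3 := by nlinarith [sq_nonneg (k + 1)]

theorem adaptedNum_det (k : ℝ) :
    (adaptedNum k).det =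
      -(64 * ((2 * k - 1) * (2 * k + 1) * (2 * k + 3)) ^ 2 * (k * (k + 1) + 3)) := by
  simp [adaptedNum, Matrix.det_succ_row_zero, Fin.sum_univ_succ, Fin.succAbove]
  ring

theorem adaptedMatrix_det (k : ℝ) :
    (adaptedMatrix k).det = (∏ i, (adaptedDen k i)⁻¹) * (adaptedNum k).det :=
  Matrix.det_mul_column _ _

theorem adaptedNum_apply_zero (k : ℝ) : ∑ j, C (adaptedNum k 0 j) * gStar k j =
    C (adaptedDen k 0) * adapted k 0 := by
  refine MvPolynomial.funext fun x => ?_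
  simp only [Fin.sum_univ_five, adaptedNum, adaptedDen, gStar, adapted, Matrix.of_apply,
    Matrix.cons_val, cubicT, cubic, H, H0, J, J0, J1, K, K0, L, l0, l1, r0, r1, h,
    map_add, map_sub, map_mul, map_pow, map_one, map_neg, map_ofNat, eval_C, eval_X]
  ring

theorem adaptedNum_apply_one (k : ℝ) : ∑ j, C (adaptedNum k 1 j) * gStar k j =
    C (adaptedDen k 1) * adapted k 1 := by
  refine MvPolynomial.funext fun x => ?_
  simp only [Fin.sum_univ_five, adaptedNum, adaptedDen, gStar, adapted, Matrix.of_apply,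
    Matrix.cons_val, cubicD, cubicDiff, H, H0, J, J0, J1, K, K0, L, l0, l1, r0, r1, h,
    map_add, map_sub, map_mul, map_pow, map_one, map_neg, map_ofNat, map_zero, eval_C, eval_X]
  ring

theorem adaptedNum_apply_two (k : ℝ) : ∑ j, C (adaptedNum k 2 j) * gStar k j =
    C (adaptedDen k 2) * adapted k 2 := by
  refine MvPolynomial.funext fun x => ?_
  simp only [Fin.sum_univ_five, adaptedNum, adaptedDen, gStar, adapted, Matrix.of_apply,
    Matrix.cons_val, cubicT, cubic, H, H0, J, J0, J1, K, K0, L, l0, l1, r0, r1, h,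
    map_add, map_sub, map_mul, map_pow, map_one, map_neg, map_ofNat, eval_C, eval_X]
  ring

theorem adaptedNum_apply_three (k : ℝ) : ∑ j, C (adaptedNum k 3 j) * gStar k j =
    C (adaptedDen k 3) * adapted k 3 := by
  refine MvPolynomial.funext fun x => ?_
  simp only [Fin.sum_univ_five, adaptedNum, adaptedDen, gStar, adapted, Matrix.of_apply,
    Matrix.cons_val, cubicS, cubic, H, H0, J, J0, J1, K, K0, L, l0, l1, r0, r1, h,
    map_add, map_sub, map_mul, map_pow, map_one, map_neg, map_ofNat, eval_C, eval_X]
  ring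

theorem adaptedMatrix_apply {k : ℝ} (hk : k ∉ ({-3 / 2, -1 / 2, 1 / 2} : Set ℝ)) (i : Fin 5) :
    ∑ j, C (adaptedMatrix k i j) * gStar k j = adapted k i := by
  have hnum : ∑ j, C (adaptedNum k i j) * gStar k j = C (adaptedDen k i) * adapted k i := by
    fin_cases i
    · exact adaptedNum_apply_zero k
    · exact adaptedNum_apply_one k
    · exact adaptedNum_apply_two k
    · exact adaptedNum_apply_three k
    · simp [Fin.sum_univ_five, adaptedNum, adaptedDen, gStar, adapted]
  simp only [adaptedMatrix, Matrix.of_apply, map_mul, mul_assoc, ← Finset.mul_sum, hnum]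
  rw [← mul_assoc, ← map_mul, inv_mul_cancel₀ (adaptedDen_ne_zero hk i), map_one, one_mul]

/-! ### Homogeneity -/

theorem gStar_isHomogeneous (k : ℝ) (i : Fin 5) : (gStar k i).IsHomogeneous 4 := by
  refine isHomogeneous_of_eval_two_mul fun x => ?_
  fin_cases i <;>
  · simp only [gStar, Fin.zero_eta, Fin.mk_one, Fin.reduceFinMk, Matrix.cons_val,
      H, H0, J, J0, J1, K, K0, L, l0, l1, r0, r1, h,
      map_add, map_sub, map_mul, map_pow, map_one, map_neg, map_ofNat, eval_C, eval_X]
    ring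

theorem cubicS_isHomogeneous (k : ℝ) : (cubicS k).IsHomogeneous 3 := by
  refine isHomogeneous_of_eval_two_mul fun x => ?_
  simp only [cubicS, cubic, l0, l1, r1, h,
      map_add, map_sub, map_mul, map_pow, map_one, map_ofNat, eval_C, eval_X]
  ring

theorem cubicT_isHomogeneous (k : ℝ) : (cubicT k).IsHomogeneous 3 := by
  refine isHomogeneous_of_eval_two_mul fun x => ?_
  simp only [cubicT, cubic, l1, r0, r1, h,
      map_add, map_sub, map_mul, map_pow, map_one, map_ofNat, eval_C, eval_X]
  ring

theorem cubicD_isHomogeneous (k : ℝ) : (cubicD k).IsHomogeneous 3 := by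
  refine isHomogeneous_of_eval_two_mul fun x => ?_
  simp only [cubicD, cubicDiff, l0, l1, r0, r1, h,
      map_add, map_sub, map_mul, map_pow, map_one, map_ofNat, eval_C, eval_X]
  ring

/-! ### The Jacobian determinant of the map -/

theorem cubicS_eq (k : ℝ) : cubicS k = cubicT k - C (k * (k + 1)) * cubicD k :=
  (cubic_sub_cubic (C (k * (k + 1))) l0 l1 r0 r1 h).symm

theorem two_mul_J (k : ℝ) : 2 * J k = twiceMid (C (k * (k + 1))) l0 l1 r0 r1 h := by
  refine MvPolynomial.funext fun x => ?_
  simp only [twiceMid, midFactor₀, midFactor₁, J, J0, J1, l0, l1, r0, r1, h,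
      map_add, map_sub, map_mul, map_pow, map_one, map_ofNat, eval_C, eval_X]
  ring

theorem h_ne_zero : h ≠ 0 := X_ne_zero 4

theorem euler {p : Poly} {d : ℕ} (hp : p.IsHomogeneous d) :
    l0 * pderiv 0 p + l1 * pderiv 1 p + r0 * pderiv 2 p + r1 * pderiv 3 p + h * pderiv 4 p =
      d * p := by
  have := hp.sum_X_mul_pderiv
  rwa [Fin.sum_univ_five, nsmul_eq_mul] at this

theorem pderiv_ofNat {σ : Type*} (i : σ) (n : ℕ) [n.AtLeastTwo] :
    pderiv i (ofNat(n) : MvPolynomial σ ℝ) = 0 :=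
  pderiv_C (a := (OfNat.ofNat n : ℝ))

theorem jacobian_adapted (k : ℝ) :
    (Matrix.of fun i j => pderiv j (adapted k i)) =
      let s (i : Fin 5) := pderiv i (cubicT k)
      let d (i : Fin 5) := pderiv i (cubicD k)
      let m : Poly := C (k * (k + 1))
      !![h * s 0, h * s 1, h * s 2, h * s 3, h * s 4 + cubicT k;
        h * d 0, h * d 1, h * d 2, h * d 3, h * d 4 + cubicD k;
        l1 * s 0, l1 * s 1 + cubicT k, l1 * s 2, l1 * s 3, l1 * s 4;
        r1 * (s 0 - m * d 0), r1 * (s 1 - m * d 1), r1 * (s 2 - m * d 2),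
          r1 * (s 3 - m * d 3) + (cubicT k - m * cubicD k), r1 * (s 4 - m * d 4);
        pderiv 0 (J k), pderiv 1 (J k), pderiv 2 (J k), pderiv 3 (J k), pderiv 4 (J k)] := by
  have hS (i : Fin 5) : pderiv i (cubicS k) =
      pderiv i (cubicT k) - C (k * (k + 1)) * pderiv i (cubicD k) := by
    rw [cubicS_eq, map_sub, pderiv_C_mul]
  ext1 i j
  fin_cases i <;> fin_cases j <;>
    simp [adapted, hS, l1, r1, h, pderiv_X, mul_comm, -map_mul]
  rw [cubicS_eq]
  simp [mul_comm]

theorem pderiv_cubicT_zero (k : ℝ) : pderiv 0 (cubicT k) = 0 := by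
  simp [cubicT, cubic, r0, r1, l1, h, pderiv_X, pderiv_ofNat]

theorem pderiv_cubicT_two (k : ℝ) : pderiv 2 (cubicT k) =
    C (k * (k + 1)) * (h * leadFactor (C (k * (k + 1))) l1 h) := by
  simp [cubicT, cubic, leadFactor, r0, r1, l1, h, pderiv_X, pderiv_ofNat]
  ring

theorem pderiv_cubicD_zero (k : ℝ) : pderiv 0 (cubicD k) =
    -(h * leadFactor (C (k * (k + 1))) r1 h) := by
  simp [cubicD, cubicDiff, leadFactor, l0, r0, r1, l1, h, pderiv_X, pderiv_ofNat]
  ring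

theorem pderiv_cubicD_two (k : ℝ) : pderiv 2 (cubicD k) =
    h * leadFactor (C (k * (k + 1))) l1 h := by
  simp [cubicD, cubicDiff, leadFactor, l0, r0, r1, l1, h, pderiv_X, pderiv_ofNat]
  ring

theorem two_mul_pderiv_J_zero (k : ℝ) : 2 * pderiv 0 (J k) =
    (C (k * (k + 1)) + 3) * h * midFactor₁ (C (k * (k + 1))) r0 r1 h
      + midFactor₀ (C (k * (k + 1))) r0 r1 h * (C (k * (k + 1)) * h) := by
  have := congrArg (pderiv 0) (two_mul_J k)
  rw [show (2 : Poly) = C 2 from rfl, pderiv_C_mul] at this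
  rw [show (2 : Poly) = C 2 from rfl, this]
  simp [twiceMid, midFactor₀, midFactor₁, l0, r0, r1, l1, h, pderiv_X, pderiv_ofNat]
  ring

theorem two_mul_pderiv_J_two (k : ℝ) : 2 * pderiv 2 (J k) =
    midFactor₀ (C (k * (k + 1))) l0 l1 h * (C (k * (k + 1)) * h)
      + (C (k * (k + 1)) + 3) * h * midFactor₁ (C (k * (k + 1))) l0 l1 h := by
  have := congrArg (pderiv 2) (two_mul_J k)
  rw [show (2 : Poly) = C 2 from rfl, pderiv_C_mul] at this
  rw [show (2 : Poly) = C 2 from rfl, this]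
  simp [twiceMid, midFactor₀, midFactor₁, l0, r0, r1, l1, h, pderiv_X, pderiv_ofNat]
  ring

theorem detJac_adapted (k : ℝ) :
    detJac (adapted k) =
      C (4 * (k * (k + 1) + 3)) * (h ^ 3 * cubicS k ^ 2 * cubicT k ^ 2) := by
  have hdet := det_adapted (C (k * (k + 1))) l0 l1 r0 r1 h (cubicT k) (cubicD k) (J k)
    _ _ _ _ _ _ _ _ _ _ _ _ _ _ _ (euler (cubicT_isHomogeneous k))
    (euler (cubicD_isHomogeneous k)) (euler (gStar_isHomogeneous k 2))
  have hminor := det_adapted_minor (C (k * (k + 1))) l0 l1 r0 r1 h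
  change _ = -(2 * _ * _ * cubicS k * cubicT k) at hminor
  rw [← two_mul_J, ← two_mul_pderiv_J_zero, ← two_mul_pderiv_J_two, ← pderiv_cubicT_two,
    ← pderiv_cubicD_zero, ← pderiv_cubicD_two, ← pderiv_cubicT_zero k] at hminor
  change Matrix.det !![_, _, cubicT k; _, _, cubicD k; _, _, _] = _ at hminor
  rw [detJac, jacobian_adapted]
  refine mul_left_cancel₀ (pow_ne_zero 3 h_ne_zero) (hdet.trans ?_)
  rw [← cubicS_eq]
  have h2 : (2 : Poly) ≠ 0 := two_ne_zero
  refine mul_left_cancel₀ h2 ?_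
  rw [Matrix.det_fin_three] at hminor ⊢
  simp only [Matrix.of_apply, Matrix.cons_val, map_mul, map_add, map_ofNat] at hminor ⊢
  linear_combination (-(4 * h ^ 4 * cubicT k * cubicS k)) * hminor

/-! ### Irreducibility of the cubics -/

theorem not_dvd_of_eval {σ : Type*} {p q : MvPolynomial σ ℝ} (x : σ → ℝ) (hp : eval x p = 0)
    (hq : eval x q ≠ 0) : ¬ p ∣ q := by
  rintro ⟨r, rfl⟩
  exact hq (by rw [map_mul, hp, zero_mul])

theorem irreducible_C_mul_X_add_X {σ : Type*} {c : ℝ} (hc : c ≠ 0) {i j : σ} (hij : j ≠ i) :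
    Irreducible (C c * X i + X j : MvPolynomial σ ℝ) := by
  classical
  refine irreducible_mul_X_add _ _ i (by simpa using hc) (by simp) (by simp [hij.symm]) ?_
  exact ((isUnit_iff_ne_zero.mpr hc).map C).isRelPrime_left

theorem irreducible_leadFactor {m : ℝ} (h0 : m ≠ 0) (h2 : m ≠ 2) :
    Irreducible (leadFactor (C m) r1 h) := by
  have : leadFactor (C m) r1 h = C (-(3 * m * (m - 2))) * X 3 + X 4 := by
    simp only [leadFactor, r1, h, map_neg, map_mul, map_sub, map_ofNat]
    ring
  rw [this]
  exact irreducible_C_mul_X_add_X (by simp [h0, sub_ne_zero.mpr h2]) (by decide)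

/-- The cubic is affine in `l₀` with relatively prime coefficients. -/
theorem irreducible_cubic {m : ℝ} (h0 : m ≠ 0) (h2 : m ≠ 2) (h6 : m ≠ 6) :
    Irreducible (cubic (C m) l0 l1 r1 h) := by
  have h2' : m - 2 ≠ 0 := sub_ne_zero.mpr h2
  have h6' : m - 6 ≠ 0 := sub_ne_zero.mpr h6
  have heq : cubic (C m) l0 l1 r1 h =
      C m * h * leadFactor (C m) r1 h * X 0 + cubic (C m) 0 l1 r1 h := by
    simp only [cubic, leadFactor, l0]
    ring
  rw [heq]
  refine irreducible_mul_X_add _ _ 0 ?_ ?_ ?_ ?_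
  · exact mul_ne_zero (mul_ne_zero (by simpa using h0) h_ne_zero)
      (irreducible_leadFactor h0 h2).ne_zero
  · apply notMem_vars_of_pderiv_eq_zero
    simp [leadFactor, r1, h, pderiv_X, pderiv_ofNat]
  · apply notMem_vars_of_pderiv_eq_zero
    simp [cubic, l1, r1, h, pderiv_X, pderiv_ofNat]
  · refine IsRelPrime.mul_left (IsRelPrime.mul_left ?_ ?_) ?_
    · exact ((isUnit_iff_ne_zero.mpr h0).map C).isRelPrime_left
    · refine (X_prime (i := (4 : Fin 5))).irreducible.isRelPrime_iff_not_dvd.mpr ?_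
      exact not_dvd_of_eval ![0, 1, 0, 1, 0] (by simp) (by simp [cubic, l1, r1, h, h0, h2', h6'])
    · refine (irreducible_leadFactor h0 h2).isRelPrime_iff_not_dvd.mpr ?_
      -- a zero of the linear factor, where the cubic takes the value `-54 m³ (m - 2)²`
      refine not_dvd_of_eval ![0, 0, 0, 1, 3 * m * (m - 2)] (by simp [leadFactor, r1, h]) ?_
      have : eval ![0, 0, 0, 1, 3 * m * (m - 2)] (cubic (C m) 0 l1 r1 h) =
          -54 * m ^ 3 * (m - 2) ^ 2 := by
        simp [cubic, l1, r1, h]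
        ring
      rw [this]
      simp [h0, h2']

/-- The quadratic factor of the cubic for `m = 6`. -/
noncomputable def quadric (x0 x1 y1 z : Poly) : Poly :=
  z ^ 2 + 6 * x0 * z - 108 * y1 * z + 180 * x1 * z - 2592 * x1 ^ 2 - 7776 * x1 * y1
    - 432 * x0 * y1

theorem cubic_six (x0 x1 y1 z : Poly) : cubic (C 6) x0 x1 y1 z = z * quadric x0 x1 y1 z := by
  simp only [cubic, quadric, map_ofNat]
  ring

theorem irreducible_quadric : Irreducible (quadric l0 l1 r1 h) := by
  have hlead := irreducible_leadFactor (m := 6) (by norm_num) (by norm_num)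
  have heq : quadric l0 l1 r1 h =
      C 6 * leadFactor (C 6) r1 h * X 0 + quadric 0 l1 r1 h := by
    simp only [quadric, leadFactor, l0, map_ofNat]
    ring
  rw [heq]
  refine irreducible_mul_X_add _ _ 0 ?_ ?_ ?_ ?_
  · exact mul_ne_zero (by simp) hlead.ne_zero
  · apply notMem_vars_of_pderiv_eq_zero
    simp [leadFactor, r1, h, pderiv_X, pderiv_ofNat]
  · apply notMem_vars_of_pderiv_eq_zero
    simp [quadric, l1, r1, h, pderiv_X, pderiv_ofNat]
  · refine IsRelPrime.mul_left ?_ ?_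
    · exact ((isUnit_iff_ne_zero.mpr (by norm_num : (6 : ℝ) ≠ 0)).map C).isRelPrime_left
    · refine hlead.isRelPrime_iff_not_dvd.mpr ?_
      refine not_dvd_of_eval ![0, 0, 0, 1, 72] ?_ ?_
      · simp [leadFactor, r1, h]; norm_num
      · simp [quadric, l1, r1, h]; norm_num

/-! ### The left-right symmetry -/

theorem LR_LR (p : Poly) : LR (LR p) = p := by
  rw [LR, LR, rename_rename]
  have : (![2, 3, 0, 1, 4] : Fin 5 → Fin 5) ∘ ![2, 3, 0, 1, 4] = id := by decide
  rw [this, rename_id_apply]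

theorem LR_C_mul (c : ℝ) (p : Poly) : LR (C c * p) = C c * LR p := by
  simp [LR]

theorem LR_cubicS (k : ℝ) : LR (cubicS k) = cubicT k := by
  simp [LR, cubicS, cubicT, cubic, l0, l1, r0, r1, h, map_ofNat]

theorem LR_quadric : LR (quadric l0 l1 r1 h) = quadric r0 r1 l1 h := by
  simp [LR, quadric, l0, l1, r0, r1, h, map_ofNat]

theorem irreducible_LR {p : Poly} (hp : Irreducible p) : Irreducible (LR p) := by
  let e : Poly ≃ₐ[ℝ] Poly := AlgEquiv.ofAlgHom (rename ![2, 3, 0, 1, 4])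
    (rename ![2, 3, 0, 1, 4]) (AlgHom.ext LR_LR) (AlgHom.ext LR_LR)
  exact (MulEquiv.irreducible_iff e).mpr hp

/-- Two polynomials are not associated if they agree, with a nonzero value, at one point
and differ at another. -/
theorem not_associated_of_eval {σ : Type*} {p q : MvPolynomial σ ℝ} (x y : σ → ℝ)
    (hx : eval x p = eval x q) (hx0 : eval x p ≠ 0) (hy : eval y p ≠ eval y q) :
    ¬ Associated p q := by
  rintro ⟨u, rfl⟩
  obtain ⟨c, -, hc⟩ := isUnit_iff_eq_C_of_isReduced.mp u.isUnit
  rw [hc, map_mul, eval_C] at hx hy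
  have : c = 1 := mul_left_cancel₀ hx0 (by rw [← hx, mul_one])
  exact hy (by rw [this, mul_one])

theorem not_associated_cubic {k : ℝ} (h0 : k * (k + 1) ≠ 0) :
    ¬ Associated (cubicS k) (cubicT k) := by
  refine not_associated_of_eval ![0, 0, 0, 0, 1] ![1, 0, 0, 0, 1] ?_ ?_ ?_
  · simp [cubicS, cubicT, cubic, l0, l1, r0, r1, h]
  · simp [cubicS, cubic, l0, l1, r1, h]
  · simpa [cubicS, cubicT, cubic, l0, l1, r0, r1, h] using h0

theorem not_associated_quadric :
    ¬ Associated (quadric l0 l1 r1 h) (quadric r0 r1 l1 h) := by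
  refine not_associated_of_eval ![0, 0, 0, 0, 1] ![1, 0, 0, 0, 1] ?_ ?_ ?_ <;>
  simp [quadric, l0, l1, r0, r1, h]

/-! ### The inverse map -/

theorem cubicS_ne_zero (k : ℝ) : cubicS k ≠ 0 := fun h0 => by
  have := congrArg (eval ![0, 0, 0, 0, 1]) h0
  simp [cubicS, cubic, l0, l1, r1, h] at this

theorem cubicT_ne_zero (k : ℝ) : cubicT k ≠ 0 := fun h0 => by
  have := congrArg (eval ![0, 0, 0, 0, 1]) h0
  simp [cubicT, cubic, r0, r1, l1, h] at this

/-- The inverse of `adapted`. In terms of the coordinates `(a : d : x : y : t)` of the target and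
`b = a - k (k + 1) d`, the first coordinates satisfy `l₁ / h = x / a` and `r₁ / h = y / b`. -/
noncomputable def inverseAdapted (k : ℝ) : Fin 5 → Poly :=
  let m : Poly := C (k * (k + 1))
  let b : Poly := X 0 - m * X 1
  let c : Poly := C ((2 * (k * (k + 1) + 3))⁻¹)
  ![c * inverseForm m (2 * X 4) (-X 1) (X 3) b (X 2) (X 0), X 2 * X 0 * b ^ 2,
    c * inverseForm m (2 * X 4) (X 1) (X 2) (X 0) (X 3) b, X 3 * X 0 ^ 2 * b, X 0 ^ 2 * b ^ 2]

theorem inverseAdapted_isHomogeneous (k : ℝ) (i : Fin 5) :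
    (inverseAdapted k i).IsHomogeneous 4 := by
  refine isHomogeneous_of_eval_two_mul fun x => ?_
  fin_cases i <;>
  · simp only [inverseAdapted, Fin.zero_eta, Fin.mk_one, Fin.reduceFinMk, Matrix.cons_val,
      inverseForm, leadFactor, recoveryForm, mixedForm,
      map_add, map_sub, map_mul, map_pow, map_neg, map_ofNat, eval_C, eval_X]
    ring

theorem bind₁_inverseForm (F : Fin 5 → Poly) (k : ℝ) (t d x u y v : Poly) :
    bind₁ F (inverseForm (C (k * (k + 1))) t d x u y v) =
      inverseForm (C (k * (k + 1))) (bind₁ F t) (bind₁ F d) (bind₁ F x) (bind₁ F u) (bind₁ F y)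
        (bind₁ F v) := by
  simp only [inverseForm, leadFactor, recoveryForm, mixedForm, map_add, map_sub, map_mul, map_pow,
    map_ofNat, algHom_C, algebraMap_eq]

theorem bind₁_adapted_inverseAdapted (k : ℝ) (i : Fin 5) :
    bind₁ (adapted k) (inverseAdapted k i) =
      h ^ 3 * cubicS k ^ 2 * cubicT k ^ 2 * X i := by
  have hb : bind₁ (adapted k) (X 0 - C (k * (k + 1)) * X 1) = h * cubicS k := by
    rw [map_sub, map_mul, bind₁_X_right, bind₁_X_right, algHom_C, algebraMap_eq, cubicS_eq]
    simp only [adapted, Matrix.cons_val]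
    ring
  have ht : bind₁ (adapted k) (2 * X 4) = twiceMid (C (k * (k + 1))) l0 l1 r0 r1 h := by
    rw [map_mul, bind₁_X_right, map_ofNat]
    exact two_mul_J k
  have hc : C ((2 * (k * (k + 1) + 3))⁻¹) * (2 * (C (k * (k + 1)) + 3)) = (1 : Poly) := by
    rw [show (2 * (C (k * (k + 1)) + 3) : Poly) = C (2 * (k * (k + 1) + 3)) by
      simp only [map_mul, map_add, map_ofNat], ← map_mul,
      inv_mul_cancel₀ (mul_pos two_pos (k_sq_add_pos k)).ne', map_one]
  fin_cases i
  · have happ := inverseForm_apply (C (k * (k + 1))) r0 r1 l0 l1 h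
    rw [cubicDiff_swap, twiceMid_swap] at happ
    change inverseForm _ _ (h * -cubicD k) (r1 * cubicS k) (h * cubicS k) (l1 * cubicT k)
      (h * cubicT k) = 2 * _ * (h ^ 3 * cubicT k ^ 2 * cubicS k ^ 2) * l0 at happ
    simp only [inverseAdapted, Fin.zero_eta, Matrix.cons_val]
    rw [map_mul, bind₁_inverseForm, hb, ht, map_neg]
    simp only [bind₁_X_right, algHom_C, algebraMap_eq, adapted, Matrix.cons_val]
    rw [← mul_neg, happ]
    simp only [l0]
    linear_combination (h ^ 3 * cubicS k ^ 2 * cubicT k ^ 2 * X 0) * hc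
  · simp only [inverseAdapted, Fin.mk_one, Matrix.cons_val]
    rw [map_mul, map_pow, hb]
    simp only [map_mul, bind₁_X_right, adapted, Matrix.cons_val, l1]
    ring
  · have happ := inverseForm_apply (C (k * (k + 1))) l0 l1 r0 r1 h
    change inverseForm _ _ (h * cubicD k) (l1 * cubicT k) (h * cubicT k) (r1 * cubicS k)
      (h * cubicS k) = 2 * _ * (h ^ 3 * cubicS k ^ 2 * cubicT k ^ 2) * r0 at happ
    simp only [inverseAdapted, Fin.reduceFinMk, Matrix.cons_val]
    rw [map_mul, bind₁_inverseForm, hb, ht]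
    simp only [bind₁_X_right, algHom_C, algebraMap_eq, adapted, Matrix.cons_val]
    rw [happ]
    simp only [r0]
    linear_combination (h ^ 3 * cubicS k ^ 2 * cubicT k ^ 2 * X 2) * hc
  · simp only [inverseAdapted, Fin.reduceFinMk, Matrix.cons_val]
    rw [map_mul, hb]
    simp only [map_mul, map_pow, bind₁_X_right, adapted, Matrix.cons_val, r1]
    ring
  · simp only [inverseAdapted, Fin.reduceFinMk, Matrix.cons_val]
    rw [map_mul, map_pow, map_pow, hb]
    simp only [bind₁_X_right, adapted, Matrix.cons_val]
    simp only [h]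
    ring

/-- If two values of a polynomial at common zeros of `p` differ, then `p` does not divide it. -/
theorem not_dvd_of_eval_ne {σ : Type*} {p q : MvPolynomial σ ℝ} (x y : σ → ℝ) (hx : eval x p = 0)
    (hy : eval y p = 0) (hq : eval x q ≠ eval y q) : ¬ p ∣ q := by
  rintro ⟨r, rfl⟩
  exact hq (by rw [map_mul, map_mul, hx, hy, zero_mul, zero_mul])

theorem noCommonFactor_inverseAdapted {k : ℝ} (h0 : k * (k + 1) ≠ 0) (h2 : k * (k + 1) ≠ 2) :
    NoCommonFactor (inverseAdapted k) := by
  have h3 : k * (k + 1) + 3 ≠ 0 := (k_sq_add_pos k).ne'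
  have h2' : k * (k + 1) - 2 ≠ 0 := sub_ne_zero.mpr h2
  set m := k * (k + 1) with hm
  have hb : Irreducible (X 0 - C m * X 1 : Poly) := by
    have := irreducible_C_mul_X_add_X (neg_ne_zero.mpr h0) (i := (1 : Fin 5)) (j := 0) (by decide)
    rwa [map_neg, neg_mul, neg_add_eq_sub] at this
  have ha : Irreducible (X 0 : Poly) := (X_prime (i := (0 : Fin 5))).irreducible
  have hI4 : inverseAdapted k 4 = X 0 ^ 2 * (X 0 - C m * X 1) ^ 2 := rfl
  refine noCommonFactor_of_irreducible (i := 4) ?_ fun p hp => ?_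
  · rw [hI4]
    exact mul_ne_zero (pow_ne_zero 2 ha.ne_zero) (pow_ne_zero 2 hb.ne_zero)
  by_contra! hall
  have h4 := hall 4
  rw [hI4] at h4
  -- on each of the two hyperplanes one component is affine in the last coordinate, with
  -- coefficient a nonzero multiple of `m (m - 2)` at the chosen points
  rcases hp.prime.dvd_or_dvd h4 with h4 | h4
  · have hdvd := (hp.dvd_symm ha (hp.prime.dvd_of_dvd_pow h4)).trans (hall 0)
    refine not_dvd_of_eval_ne ![0, -1, 1, 0, 0] ![0, -1, 1, 0, 1] (by simp) (by simp) ?_ hdvd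
    simp only [inverseAdapted, Matrix.cons_val, inverseForm, leadFactor, recoveryForm, mixedForm,
      map_add, map_sub, map_mul, map_pow, map_neg, map_ofNat, eval_C, eval_X, ← hm]
    intro heq
    have : (2 * (m + 3))⁻¹ * (6 * m ^ 3 * (m - 2)) = 0 := by
      linear_combination heq
    simp [h0, h2', h3] at this
  · have hdvd := (hp.dvd_symm hb (hp.prime.dvd_of_dvd_pow h4)).trans (hall 2)
    refine not_dvd_of_eval_ne ![m, 1, 0, 1, 0] ![m, 1, 0, 1, 1] (by simp) (by simp) ?_ hdvd
    simp only [inverseAdapted, Matrix.cons_val, inverseForm, leadFactor, recoveryForm, mixedForm,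
      map_add, map_sub, map_mul, map_pow, map_ofNat, eval_C, eval_X, ← hm]
    intro heq
    have : (2 * (m + 3))⁻¹ * (6 * m ^ 3 * (m - 2)) = 0 := by
      linear_combination heq
    simp [h0, h2', h3] at this

/-! ### The map `gStar` -/

theorem adaptedMatrix_det_ne_zero {k : ℝ} (hk : k ∉ ({-3 / 2, -1 / 2, 1 / 2} : Set ℝ)) :
    (adaptedMatrix k).det ≠ 0 := by
  have hden := adaptedDen_ne_zero hk 0
  have he : (2 * k - 1) * (2 * k + 1) * (2 * k + 3) ≠ 0 := right_ne_zero_of_mul hden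
  rw [adaptedMatrix_det, adaptedNum_det]
  refine mul_ne_zero (Finset.prod_ne_zero_iff.mpr fun i _ => inv_ne_zero (adaptedDen_ne_zero hk i))
    (neg_ne_zero.mpr (mul_ne_zero (mul_ne_zero (by norm_num) (pow_ne_zero 2 he))
      (k_sq_add_pos k).ne'))

/-- The constant in the Jacobian determinant, for the cubics normalised by `h³`. -/
noncomputable def jacConst (k : ℝ) : ℝ := 4 * (k * (k + 1) + 3) / (adaptedMatrix k).det

theorem jacConst_ne_zero {k : ℝ} (hk : k ∉ ({-3 / 2, -1 / 2, 1 / 2} : Set ℝ)) :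
    jacConst k ≠ 0 :=
  div_ne_zero (mul_pos four_pos (k_sq_add_pos k)).ne' (adaptedMatrix_det_ne_zero hk)

theorem detJac_gStar {k : ℝ} (hk : k ∉ ({-3 / 2, -1 / 2, 1 / 2} : Set ℝ)) :
    detJac (gStar k) = C (jacConst k) *
      (h ^ 3 * cubicS k ^ 2 * cubicT k ^ 2) := by
  have hlin := detJac_linear (adaptedMatrix k) (gStar k) (adapted k) (adaptedMatrix_apply hk)
  have hdet := adaptedMatrix_det_ne_zero hk
  have hC : (C (adaptedMatrix k).det : Poly) ≠ 0 := by simpa using hdet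
  refine mul_left_cancel₀ hC ?_
  rw [jacConst, ← hlin, detJac_adapted, ← mul_assoc (C (adaptedMatrix k).det), ← map_mul,
    mul_div_cancel₀ _ hdet]

/-- The inverse of `gStar`, by quartic forms. -/
noncomputable def inverseGStar (k : ℝ) (i : Fin 5) : Poly :=
  bind₁ (linearForms (adaptedMatrix k)) (inverseAdapted k i)

theorem bind₁_gStar_inverseGStar {k : ℝ} (hk : k ∉ ({-3 / 2, -1 / 2, 1 / 2} : Set ℝ))
    (i : Fin 5) : bind₁ (gStar k) (inverseGStar k i) =
      h ^ 3 * cubicS k ^ 2 * cubicT k ^ 2 * X i := by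
  rw [inverseGStar, bind₁_bind₁, ← bind₁_adapted_inverseAdapted]
  simp only [bind₁_linearForms, adaptedMatrix_apply hk]

theorem gStar_isRationalMap {k : ℝ} (hk : k ∉ ({-3 / 2, -1 / 2, 1 / 2} : Set ℝ)) :
    IsRationalMap (gStar k) 4 := by
  refine ⟨gStar_isHomogeneous k, ?_⟩
  by_contra! hall
  have := adaptedMatrix_apply hk 0
  simp only [hall, mul_zero, Finset.sum_const_zero] at this
  exact mul_ne_zero h_ne_zero (cubicT_ne_zero k) this.symm

theorem inverseGStar_isRationalMap {k : ℝ} (hk : k ∉ ({-3 / 2, -1 / 2, 1 / 2} : Set ℝ)) :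
    IsRationalMap (inverseGStar k) 4 := by
  refine ⟨fun i => ?_, 4, fun h0 => ?_⟩
  · have := (inverseAdapted_isHomogeneous k i).aeval _
      (linearForms_isHomogeneous (adaptedMatrix k))
    rwa [one_mul] at this
  · have := bind₁_gStar_inverseGStar hk 4
    rw [h0, map_zero] at this
    exact mul_ne_zero (mul_ne_zero (mul_ne_zero (pow_ne_zero 3 h_ne_zero)
      (pow_ne_zero 2 (cubicS_ne_zero k))) (pow_ne_zero 2 (cubicT_ne_zero k))) (X_ne_zero 4)
      this.symm

theorem areInverse_gStar {k : ℝ} (hk : k ∉ ({-3 / 2, -1 / 2, 1 / 2} : Set ℝ)) :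
    AreInverse (gStar k) (inverseGStar k) := by
  have hΦ : h ^ 3 * cubicS k ^ 2 * cubicT k ^ 2 ≠ 0 :=
    mul_ne_zero (mul_ne_zero (pow_ne_zero 3 h_ne_zero)
      (pow_ne_zero 2 (cubicS_ne_zero k))) (pow_ne_zero 2 (cubicT_ne_zero k))
  refine areInverse_of_leftInverse (gStar_isRationalMap hk) ?_ hΦ (bind₁_gStar_inverseGStar hk)
  rw [detJac_gStar hk]
  exact mul_ne_zero (by simpa using jacConst_ne_zero hk) hΦ

theorem irreducible_cubicS {k : ℝ} (h0 : k * (k + 1) ≠ 0) (h2 : k * (k + 1) ≠ 2)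
    (h6 : k * (k + 1) ≠ 6) : Irreducible (cubicS k) := irreducible_cubic h0 h2 h6

theorem irreducible_cubicT {k : ℝ} (h0 : k * (k + 1) ≠ 0) (h2 : k * (k + 1) ≠ 2)
    (h6 : k * (k + 1) ≠ 6) : Irreducible (cubicT k) :=
  LR_cubicS k ▸ irreducible_LR (irreducible_cubicS h0 h2 h6)

theorem noCommonFactor_gStar {k : ℝ} (hk : k ∉ ({-3 / 2, -1 / 2, 1 / 2} : Set ℝ))
    (h0 : k * (k + 1) ≠ 0) (h2 : k * (k + 1) ≠ 2) (h6 : k * (k + 1) ≠ 6) :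
    NoCommonFactor (gStar k) := by
  obtain ⟨i, hi⟩ := (gStar_isRationalMap hk).2
  refine noCommonFactor_of_irreducible hi fun p hp => ?_
  by_contra! hall
  have hA : ∀ i, p ∣ adapted k i := fun i => by
    rw [← adaptedMatrix_apply hk i]
    exact Finset.dvd_sum fun j _ => (hall j).mul_left _
  have hT : p ∣ h * cubicT k := hA 0
  have hS : p ∣ h * cubicS k := by
    rw [cubicS_eq, mul_sub, mul_left_comm]
    exact dvd_sub hT ((hA 1).mul_left _)
  by_cases hph : p ∣ h
  · have hl : h ∣ l1 * cubicT k :=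
      (hp.dvd_symm (X_prime (i := (4 : Fin 5))).irreducible hph).trans (hA 2)
    refine not_dvd_of_eval ![0, 1, 0, 1, 0] (by simp [h]) ?_ hl
    have : eval ![0, 1, 0, 1, 0] (l1 * cubicT k) =
        9 * (k * (k + 1)) ^ 3 * (k * (k + 1) - 2) ^ 2 * (k * (k + 1) - 6) := by
      simp [cubicT, cubic, l1, r0, r1, h]
    rw [this]
    exact mul_ne_zero (mul_ne_zero (mul_ne_zero (by norm_num) (pow_ne_zero 3 h0))
      (pow_ne_zero 2 (sub_ne_zero.mpr h2))) (sub_ne_zero.mpr h6)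
  · have hpS := (hp.prime.dvd_or_dvd hS).resolve_left hph
    have hpT := (hp.prime.dvd_or_dvd hT).resolve_left hph
    exact not_associated_cubic h0
      ((hp.associated_of_dvd (irreducible_cubicS h0 h2 h6) hpS).symm.trans
        (hp.associated_of_dvd (irreducible_cubicT h0 h2 h6) hpT))

theorem ne_of_notMem {k : ℝ} (hk : k ∉ ({-3, -2, -1, 0, 1, 2} : Set ℝ)) :
    k * (k + 1) ≠ 0 ∧ k * (k + 1) ≠ 2 ∧ k * (k + 1) ≠ 6 := by
  simp only [Set.mem_insert_iff, Set.mem_singleton_iff, not_or] at hk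
  obtain ⟨h3, h2, h1, h0, g1, g2⟩ := hk
  refine ⟨mul_ne_zero h0 fun h => h1 (by linarith), fun h => ?_, fun h => ?_⟩
  · have : (k - 1) * (k + 2) = 0 := by linarith
    rcases mul_eq_zero.mp this with h' | h'
    · exact g1 (by linarith)
    · exact h2 (by linarith)
  · have : (k - 2) * (k + 3) = 0 := by linarith
    rcases mul_eq_zero.mp this with h' | h'
    · exact g2 (by linarith)
    · exact h3 (by linarith)

/-- The quadratic form `Q` with `cubicS k = 9 cubicCoeff k l₁² r₁ + h Q`, where `m = k (k + 1)`. -/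
noncomputable def restForm (m : Poly) : Poly :=
  h ^ 2 + m * l0 * h - 3 * m ^ 2 * r1 * h + 6 * m * (m - 1) * l1 * h
    - 3 * m ^ 3 * (m - 2) * l1 ^ 2 - 18 * (m - 3) * m ^ 2 * (m - 2) * l1 * r1
    - 3 * m ^ 2 * (m - 2) * l0 * r1

theorem restForm_isHomogeneous (k : ℝ) :
    (C (1 / 9) * restForm (C (k * (k + 1)))).IsHomogeneous 2 := by
  refine isHomogeneous_of_eval_two_mul fun x => ?_
  simp only [restForm, l0, l1, r1, h, map_add, map_sub, map_mul, map_pow, map_one, map_ofNat,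
    eval_C, eval_X]
  ring

theorem cubicS_eq_cubicCoeff (k : ℝ) : C (1 / 9) * cubicS k =
    C (cubicCoeff k) * l1 ^ 2 * r1 + h * (C (1 / 9) * restForm (C (k * (k + 1)))) := by
  refine MvPolynomial.funext fun x => ?_
  simp only [cubicS, cubic, cubicCoeff, restForm, l0, l1, r1, h, map_add, map_sub, map_mul,
    map_pow, map_one, map_ofNat, eval_C, eval_X]
  ring

theorem cubicS_of_eq_two {k : ℝ} (hk : k * (k + 1) = 2) :
    cubicS k = h ^ 2 * (2 * l0 - 12 * r1 + 12 * l1 + h) := by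
  simp only [cubicS, cubic, hk, map_ofNat]
  ring

theorem cubicT_of_eq_two {k : ℝ} (hk : k * (k + 1) = 2) :
    cubicT k = h ^ 2 * (2 * r0 - 12 * l1 + 12 * r1 + h) := by
  simp only [cubicT, cubic, hk, map_ofNat]
  ring

theorem cubicS_of_eq_zero {k : ℝ} (hk : k * (k + 1) = 0) : cubicS k = h ^ 3 := by
  simp only [cubicS, cubic, hk, map_zero]
  ring

theorem cubicT_of_eq_zero {k : ℝ} (hk : k * (k + 1) = 0) : cubicT k = h ^ 3 := by
  simp only [cubicT, cubic, hk, map_zero]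
  ring

theorem quadric_isHomogeneous : (C (1 / 9) * quadric l0 l1 r1 h).IsHomogeneous 2 := by
  refine isHomogeneous_of_eval_two_mul fun x => ?_
  simp only [quadric, l0, l1, r1, h, map_add, map_sub, map_mul, map_pow, map_ofNat,
    eval_C, eval_X]
  ring

/-- Rescaling the two cubics by `1 / 9` gives them the leading coefficient `cubicCoeff k`. -/
theorem C_jacConst_mul (k : ℝ) (p q r : Poly) :
    C (jacConst k) * (p * q ^ 2 * r ^ 2) =
      C (jacConst k * 9 ^ 4) * p * (C (1 / 9) * q) ^ 2 * (C (1 / 9) * r) ^ 2 := by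
  have hC : C (jacConst k * 9 ^ 4) * C (1 / 9) ^ 4 = (C (jacConst k) : Poly) := by
    rw [← map_pow, ← map_mul]
    exact congrArg C (by ring)
  linear_combination (-(p * q ^ 2 * r ^ 2)) * hC

theorem isUnit_C_ninth : IsUnit (C (1 / 9) : Poly) :=
  (isUnit_iff_ne_zero.mpr (by norm_num : (1 / 9 : ℝ) ≠ 0)).map C

theorem hasBidegree_gStar {k : ℝ} (hk : k ∉ ({-3 / 2, -1 / 2, 1 / 2} : Set ℝ))
    (hk' : k ∉ ({-3, -2, -1, 0, 1, 2} : Set ℝ)) : HasBidegree (gStar k) 4 4 := by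
  obtain ⟨h0, h2, h6⟩ := ne_of_notMem hk'
  exact ⟨gStar k, 1, one_ne_zero, fun i => (one_mul _).symm, gStar_isRationalMap hk,
    noCommonFactor_gStar hk h0 h2 h6, inverseGStar k, inverseGStar_isRationalMap hk,
    noCommonFactor_bind₁_linearForms (isUnit_iff_ne_zero.mpr (adaptedMatrix_det_ne_zero hk))
      (noCommonFactor_inverseAdapted h0 h2), areInverse_gStar hk⟩

theorem irreducible_and_not_associated {k : ℝ} (hk : k ∉ ({-3, -2, -1, 0, 1, 2} : Set ℝ)) :
    Irreducible (C (1 / 9) * cubicS k) ∧ Irreducible (C (1 / 9) * cubicT k) ∧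
      ¬ Associated (C (1 / 9) * cubicS k) (C (1 / 9) * cubicT k) := by
  obtain ⟨h0, h2, h6⟩ := ne_of_notMem hk
  refine ⟨(irreducible_isUnit_mul isUnit_C_ninth).mpr (irreducible_cubicS h0 h2 h6),
    (irreducible_isUnit_mul isUnit_C_ninth).mpr (irreducible_cubicT h0 h2 h6), fun hass => ?_⟩
  exact not_associated_cubic h0 ((associated_isUnit_mul_left_iff isUnit_C_ninth).mp
    ((associated_isUnit_mul_right_iff isUnit_C_ninth).mp hass))

theorem factorization_of_eq_six {k : ℝ} (hk : k ∉ ({-3 / 2, -1 / 2, 1 / 2} : Set ℝ))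
    (hm : k * (k + 1) = 6) :
    ∃ q : Poly, q.IsHomogeneous 2 ∧ Irreducible q ∧ Irreducible (LR q) ∧
      ¬ Associated q (LR q) ∧ C (1 / 9) * cubicS k = h * q ∧ C (1 / 9) * cubicT k = h * LR q ∧
      detJac (gStar k) = C (jacConst k * 9 ^ 4) * h ^ 7 * q ^ 2 * LR q ^ 2 := by
  have hS : cubicS k = h * quadric l0 l1 r1 h := by
    rw [← cubic_six, cubicS, hm]
  have hT : cubicT k = h * quadric r0 r1 l1 h := by
    rw [← cubic_six, cubicT, hm]
  have hirr := (irreducible_isUnit_mul isUnit_C_ninth).mpr irreducible_quadric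
  refine ⟨C (1 / 9) * quadric l0 l1 r1 h, quadric_isHomogeneous, hirr, irreducible_LR hirr, ?_⟩
  rw [LR_C_mul, LR_quadric]
  refine ⟨fun hass => not_associated_quadric ((associated_isUnit_mul_left_iff isUnit_C_ninth).mp
    ((associated_isUnit_mul_right_iff isUnit_C_ninth).mp hass)), ?_, ?_, ?_⟩
  · rw [hS, mul_left_comm]
  · rw [hT, mul_left_comm]
  · rw [detJac_gStar hk, hS, hT, ← C_jacConst_mul]
    ring

theorem factorization_of_eq_two {k : ℝ} (hk : k ∉ ({-3 / 2, -1 / 2, 1 / 2} : Set ℝ))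
    (hm : k * (k + 1) = 2) :
    ∃ a c' : ℝ, a ≠ 0 ∧ c' ≠ 0 ∧
      C (1 / 9) * cubicS k = C a * h ^ 2 * (2 * l0 - 12 * r1 + 12 * l1 + h) ∧
      C (1 / 9) * cubicT k = C a * h ^ 2 * (2 * r0 - 12 * l1 + 12 * r1 + h) ∧
      detJac (gStar k) = C c' * h ^ 11 * (2 * l0 - 12 * r1 + 12 * l1 + h) ^ 2 *
        (2 * r0 - 12 * l1 + 12 * r1 + h) ^ 2 := by
  refine ⟨1 / 9, jacConst k, by norm_num, jacConst_ne_zero hk, ?_, ?_, ?_⟩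
  · rw [cubicS_of_eq_two hm, mul_assoc]
  · rw [cubicT_of_eq_two hm, mul_assoc]
  · rw [detJac_gStar hk, cubicS_of_eq_two hm, cubicT_of_eq_two hm]
    generalize 2 * l0 - 12 * r1 + 12 * l1 + h = u
    generalize 2 * r0 - 12 * l1 + 12 * r1 + h = v
    ring

theorem factorization_of_eq_zero {k : ℝ} (hk : k ∉ ({-3 / 2, -1 / 2, 1 / 2} : Set ℝ))
    (hm : k * (k + 1) = 0) :
    ∃ a c' : ℝ, a ≠ 0 ∧ c' ≠ 0 ∧ C (1 / 9) * cubicS k = C a * h ^ 3 ∧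
      C (1 / 9) * cubicT k = C a * h ^ 3 ∧ detJac (gStar k) = C c' * h ^ 15 := by
  refine ⟨1 / 9, jacConst k, by norm_num, jacConst_ne_zero hk, ?_, ?_, ?_⟩
  · rw [cubicS_of_eq_zero hm]
  · rw [cubicT_of_eq_zero hm]
  · rw [detJac_gStar hk, cubicS_of_eq_zero hm, cubicT_of_eq_zero hm]
    ring

end TwoSided

theorem mainTheorem2 (k : ℝ) (hk : k ∉ ({-3 / 2, -1 / 2, 1 / 2} : Set ℝ)) :
    -- birationality, with quartic forms for the map and for its inverse
    TwoSided.IsBirational (TwoSided.gStar k) 4 4 ∧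
    -- the bidegree, unless the forms acquire common factors
    (k ∉ ({-3, -2, -1, 0, 1, 2} : Set ℝ) → TwoSided.HasBidegree (TwoSided.gStar k) 4 4) ∧
    -- the Jacobian determinant and the two conjugate cubics
    ∃ (c : ℝ) (S Sbar Q : TwoSided.Poly),
      c ≠ 0 ∧ S.IsHomogeneous 3 ∧ Sbar.IsHomogeneous 3 ∧ Q.IsHomogeneous 2 ∧
      TwoSided.LR S = Sbar ∧ TwoSided.LR Sbar = S ∧
      S = MvPolynomial.C (TwoSided.cubicCoeff k) * TwoSided.l1 ^ 2 * TwoSided.r1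
        + TwoSided.h * Q ∧
      TwoSided.detJac (TwoSided.gStar k)
        = MvPolynomial.C c * TwoSided.h ^ 3 * S ^ 2 * Sbar ^ 2 ∧
      -- in general the cubics are irreducible and distinct
      (k ∉ ({-3, -2, -1, 0, 1, 2} : Set ℝ) →
        Irreducible S ∧ Irreducible Sbar ∧ ¬ Associated S Sbar) ∧
      -- for six values of k they factor
      (k ∈ ({-3, 2} : Set ℝ) →
        ∃ q : TwoSided.Poly, q.IsHomogeneous 2 ∧
          Irreducible q ∧ Irreducible (TwoSided.LR q) ∧ ¬ Associated q (TwoSided.LR q) ∧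
          S = TwoSided.h * q ∧ Sbar = TwoSided.h * TwoSided.LR q ∧
          TwoSided.detJac (TwoSided.gStar k)
            = MvPolynomial.C c * TwoSided.h ^ 7 * q ^ 2 * TwoSided.LR q ^ 2) ∧
      (k ∈ ({-2, 1} : Set ℝ) →
        ∃ a c' : ℝ, a ≠ 0 ∧ c' ≠ 0 ∧
          S = MvPolynomial.C a * TwoSided.h ^ 2 *
            (2 * TwoSided.l0 - 12 * TwoSided.r1 + 12 * TwoSided.l1 + TwoSided.h) ∧
          Sbar = MvPolynomial.C a * TwoSided.h ^ 2 *
            (2 * TwoSided.r0 - 12 * TwoSided.l1 + 12 * TwoSided.r1 + TwoSided.h) ∧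
          TwoSided.detJac (TwoSided.gStar k)
            = MvPolynomial.C c' * TwoSided.h ^ 11 *
              (2 * TwoSided.l0 - 12 * TwoSided.r1 + 12 * TwoSided.l1 + TwoSided.h) ^ 2 *
              (2 * TwoSided.r0 - 12 * TwoSided.l1 + 12 * TwoSided.r1 + TwoSided.h) ^ 2) ∧
      (k ∈ ({-1, 0} : Set ℝ) →
        ∃ a c' : ℝ, a ≠ 0 ∧ c' ≠ 0 ∧
          S = MvPolynomial.C a * TwoSided.h ^ 3 ∧ Sbar = MvPolynomial.C a * TwoSided.h ^ 3 ∧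
          TwoSided.detJac (TwoSided.gStar k) = MvPolynomial.C c' * TwoSided.h ^ 15) := by
  have hLR : TwoSided.LR (C (1 / 9) * TwoSided.cubicS k) = C (1 / 9) * TwoSided.cubicT k := by
    rw [TwoSided.LR_C_mul, TwoSided.LR_cubicS]
  refine ⟨⟨TwoSided.gStar_isRationalMap hk, _, TwoSided.inverseGStar_isRationalMap hk,
      TwoSided.areInverse_gStar hk⟩, TwoSided.hasBidegree_gStar hk,
    TwoSided.jacConst k * 9 ^ 4, C (1 / 9) * TwoSided.cubicS k, C (1 / 9) * TwoSided.cubicT k,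
    C (1 / 9) * TwoSided.restForm (C (k * (k + 1))),
    mul_ne_zero (TwoSided.jacConst_ne_zero hk) (by norm_num),
    (TwoSided.cubicS_isHomogeneous k).C_mul _, (TwoSided.cubicT_isHomogeneous k).C_mul _,
    TwoSided.restForm_isHomogeneous k, hLR, by rw [← hLR, TwoSided.LR_LR],
    TwoSided.cubicS_eq_cubicCoeff k,
    (TwoSided.detJac_gStar hk).trans (TwoSided.C_jacConst_mul k _ _ _),
    TwoSided.irreducible_and_not_associated, fun hk' => ?_, fun hk' => ?_, fun hk' => ?_⟩
  · exact TwoSided.factorization_of_eq_six hk (by rcases hk' with rfl | rfl <;> norm_num)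
  · exact TwoSided.factorization_of_eq_two hk (by rcases hk' with rfl | rfl <;> norm_num)
  · exact TwoSided.factorization_of_eq_zero hk (by rcases hk' with rfl | rfl <;> norm_num)
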